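/- Call a set of lines through the origin in $\mathbb{R}^n$ equiangular with common angle $\theta$ if any two distinct lines of the set meet at the (non-obtuse) angle $\theta$. For every $\alpha \in (0,1)$ there is $n_0 = n_0(\alpha)$ such that for all $n \ge n_0$ the following holds: if $\alpha = \frac13$, then the maximum cardinality of a set of equiangular lines in $\mathbb{R}^n$ with common angle $\arccos\alpha$ is exactly $2n-2$; if $\alpha \neq \frac13$, then this maximum is at most $1.93\,n$. -/

import Mathlib

open scoped LinearAlgebra.Projectivization

namespace EquiangularLines

/-- The (non-obtuse) angle between two lines through the origin: the smaller one of the two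
supplementary angles spanned by direction vectors of the lines.  It does not depend on the choice
of the direction vectors, see `lineAngle_mk`. -/
noncomputable def lineAngle {E : Type*} [NormedAddCommGroup E] [InnerProductSpace ℝ E]
    (l m : ℙ ℝ E) : ℝ :=
  min (InnerProductGeometry.angle l.rep m.rep)
    (Real.pi - InnerProductGeometry.angle l.rep m.rep)

theorem min_angle_smul_smul {E : Type*} [NormedAddCommGroup E] [InnerProductSpace ℝ E]
    (u v : E) {a b : ℝ} (ha : a ≠ 0) (hb : b ≠ 0) :
    min (InnerProductGeometry.angle (a • u) (b • v))
        (Real.pi - InnerProductGeometry.angle (a • u) (b • v)) =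
      min (InnerProductGeometry.angle u v) (Real.pi - InnerProductGeometry.angle u v) := by
  rcases lt_or_gt_of_ne ha with ha | ha <;> rcases lt_or_gt_of_ne hb with hb | hb <;>
    simp [InnerProductGeometry.angle_smul_left_of_neg, InnerProductGeometry.angle_smul_right_of_neg,
      InnerProductGeometry.angle_smul_left_of_pos, InnerProductGeometry.angle_smul_right_of_pos,
      InnerProductGeometry.angle_neg_left, InnerProductGeometry.angle_neg_right, ha, hb, min_comm]

/-- The angle between the lines spanned by two nonzero vectors. -/
theorem lineAngle_mk {E : Type*} [NormedAddCommGroup E] [InnerProductSpace ℝ E]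
    (u v : E) (hu : u ≠ 0) (hv : v ≠ 0) :
    lineAngle (Projectivization.mk ℝ u hu) (Projectivization.mk ℝ v hv) =
      min (InnerProductGeometry.angle u v) (Real.pi - InnerProductGeometry.angle u v) := by
  obtain ⟨a, ha⟩ := Projectivization.exists_smul_eq_mk_rep ℝ u hu
  obtain ⟨b, hb⟩ := Projectivization.exists_smul_eq_mk_rep ℝ v hv
  rw [lineAngle, ← ha, ← hb]
  exact min_angle_smul_smul u v a.ne_zero b.ne_zero

/-- A set of lines through the origin is equiangular with common angle `θ` if any two distinct
lines of the set have angle `θ`. -/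
def IsEquiangular {E : Type*} [NormedAddCommGroup E] [InnerProductSpace ℝ E]
    (L : Set (ℙ ℝ E)) (θ : ℝ) : Prop :=
  L.Pairwise fun l m => lineAngle l m = θ

/-- The possible cardinalities (`⊤` for infinite sets) of sets of equiangular lines in `ℝⁿ` with
common angle `θ`. -/
def cardinalities (n : ℕ) (θ : ℝ) : Set ℕ∞ :=
  {k | ∃ L : Set (ℙ ℝ (EuclideanSpace ℝ (Fin n))), IsEquiangular L θ ∧ L.encard = k}

end EquiangularLines

/-! Choose a unit vector on each of N lines and let A be the adjacency matrix of the graph of obtuse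
pairs. The Gram matrix is (1-α)I + αJ - 2αA, so lam·I - A + J/2 is positive semidefinite for lam =
(1-α)/(2α) (`FormBound`). A linear relation among the vectors with coefficient sum zero is an
eigenvector of A for lam, hence N ≤ n + 1 + dim U for the space U of such relations.

Ramsey's theorem and sign changes make all degrees bounded in terms of α (`exists_signs_degree_le`).
If the form of A exceeds lam at a vector supported near some vertex, then U embeds into the
functions on a bounded neighbourhood (`FormBound.finrank_le_of_support`), and N ≤ n + O(1).
Otherwise ‖A² e_v‖ ≤ lam·‖A e_v‖ for every v, which bounds the average degree by (lam² + 1)/2. If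
lam² ≥ 2, a trace estimate gives dim U ≤ 3N/7, so N ≤ 7(n+1)/4. If lam² < 2, the graph is a
matching, and U = 0 unless lam = 1, that is α = 1/3. In that case all relations lie in a proper
subspace of an eigenspace of dimension at most N/2, so N ≤ 2n - 2; the vectors e₀ ± √2 eᵢ attain
this. -/

open scoped Matrix

namespace EquiangularLines

/-! ### Ramsey's theorem -/

/-- The finite Ramsey theorem for graphs. -/
theorem exists_ramsey_bound (k l : ℕ) : ∃ R : ℕ, ∀ (V : Type) (G : SimpleGraph V) (s : Finset V),
    R ≤ s.card → (∃ t ⊆ s, t.card = k ∧ G.IsClique (t : Set V)) ∨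
      (∃ t ⊆ s, t.card = l ∧ G.IsIndepSet (t : Set V)) := by
  induction k generalizing l with
  | zero => exact ⟨0, fun V G s _ => Or.inl ⟨∅, by simp⟩⟩
  | succ k ihk =>
    induction l with
    | zero => exact ⟨0, fun V G s _ => Or.inr ⟨∅, by simp⟩⟩
    | succ l ihl =>
      obtain ⟨R₁, h₁⟩ := ihk (l + 1)
      obtain ⟨R₂, h₂⟩ := ihl
      refine ⟨R₁ + R₂ + 1, fun V G s hs => ?_⟩
      classical
      obtain ⟨v, hv⟩ : s.Nonempty := Finset.card_pos.1 (by omega)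
      have hc : ((s.erase v).filter (G.Adj v)).card + ((s.erase v).filter (¬ G.Adj v ·)).card
          = s.card - 1 := by
        rw [Finset.card_filter_add_card_filter_not, Finset.card_erase_of_mem hv]
      have hsub (p : V → Prop) [DecidablePred p] : (s.erase v).filter p ⊆ s :=
        (Finset.filter_subset _ _).trans (Finset.erase_subset _ _)
      by_cases hR : R₁ ≤ ((s.erase v).filter (G.Adj v)).card
      · rcases h₁ V G _ hR with ⟨t, hts, htc, ht⟩ | ⟨t, hts, htc, ht⟩
        · have hvt : v ∉ t := fun h => by simpa using hts h
          refine Or.inl ⟨insert v t, Finset.insert_subset hv (hts.trans (hsub _)), ?_, ?_⟩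
          · rw [Finset.card_insert_of_notMem hvt, htc]
          · rw [Finset.coe_insert]
            exact ht.insert fun b hb _ => (Finset.mem_filter.1 (hts hb)).2
        · exact Or.inr ⟨t, hts.trans (hsub _), htc, ht⟩
      · rcases h₂ V G ((s.erase v).filter (¬ G.Adj v ·)) (by omega) with
          ⟨t, hts, htc, ht⟩ | ⟨t, hts, htc, ht⟩
        · exact Or.inl ⟨t, hts.trans (hsub _), htc, ht⟩
        · have hvt : v ∉ t := fun h => by simpa using hts h
          refine Or.inr ⟨insert v t, Finset.insert_subset hv (hts.trans (hsub _)), ?_, ?_⟩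
          · rw [Finset.card_insert_of_notMem hvt, htc]
          · rw [Finset.coe_insert]
            intro a ha b hb hab
            rcases ha with rfl | ha <;> rcases hb with rfl | hb
            · exact absurd rfl hab
            · exact (Finset.mem_filter.1 (hts hb)).2
            · exact fun h => (Finset.mem_filter.1 (hts ha)).2 h.symm
            · exact ht ha hb hab

/-! ### Test vectors in the semidefinite inequality -/

section Graph

/-- The indicator vector of a finite set. -/
def ind {ι : Type} [DecidableEq ι] (s : Finset ι) : ι → ℝ := fun i => if i ∈ s then 1 else 0

theorem ind_nonneg {ι : Type} [DecidableEq ι] (s : Finset ι) : 0 ≤ ind s := fun i => by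
  unfold ind; positivity

variable {ι : Type} [Fintype ι] (G : SimpleGraph ι) [DecidableRel G.Adj]

/-- The bilinear form of the adjacency matrix of a graph. -/
def adjForm (x y : ι → ℝ) : ℝ := x ⬝ᵥ (G.adjMatrix ℝ *ᵥ y)

/-- The condition that `lam • 1 - A + J / 2` is positive semidefinite, where `A` is the adjacency
matrix and `J` is the all-ones matrix. -/
def FormBound (lam : ℝ) : Prop :=
  ∀ x : ι → ℝ, adjForm G x x ≤ lam * (x ⬝ᵥ x) + (∑ i, x i) ^ 2 / 2

theorem adjForm_comm (x y : ι → ℝ) : adjForm G x y = adjForm G y x := by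
  unfold adjForm
  rw [Matrix.dotProduct_mulVec, ← Matrix.mulVec_transpose, SimpleGraph.transpose_adjMatrix,
    dotProduct_comm]

theorem adjForm_add_left (x y z : ι → ℝ) : adjForm G (x + y) z = adjForm G x z + adjForm G y z := by
  simp [adjForm, add_dotProduct]

theorem adjForm_sub_left (x y z : ι → ℝ) : adjForm G (x - y) z = adjForm G x z - adjForm G y z := by
  simp [adjForm, sub_dotProduct]

theorem adjForm_smul_left (c : ℝ) (x z : ι → ℝ) : adjForm G (c • x) z = c * adjForm G x z := by
  simp [adjForm, smul_dotProduct]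

theorem adjForm_add_right (x y z : ι → ℝ) :
    adjForm G z (x + y) = adjForm G z x + adjForm G z y := by
  simp [adjForm, Matrix.mulVec_add, dotProduct_add]

theorem adjForm_sub_right (x y z : ι → ℝ) :
    adjForm G z (x - y) = adjForm G z x - adjForm G z y := by
  simp [adjForm, Matrix.mulVec_sub, dotProduct_sub]

theorem adjForm_smul_right (c : ℝ) (x z : ι → ℝ) : adjForm G z (c • x) = c * adjForm G z x := by
  simp [adjForm, Matrix.mulVec_smul, dotProduct_smul]

theorem adjForm_eq_sum (x y : ι → ℝ) :
    adjForm G x y = ∑ i, ∑ j ∈ G.neighborFinset i, x i * y j := by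
  simp [adjForm, dotProduct, SimpleGraph.adjMatrix_mulVec_apply, Finset.mul_sum]

theorem adjForm_nonneg {x y : ι → ℝ} (hx : 0 ≤ x) (hy : 0 ≤ y) : 0 ≤ adjForm G x y := by
  rw [adjForm_eq_sum]
  exact Finset.sum_nonneg fun i _ => Finset.sum_nonneg fun j _ => mul_nonneg (hx i) (hy j)

/-- Passing to absolute values keeps the norm and does not lower the form, so nonnegative test
vectors suffice; two of them can be combined to coordinate sum zero. -/
theorem adjForm_le_abs (x y : ι → ℝ) : adjForm G x y ≤ adjForm G |x| |y| := by
  simp only [adjForm_eq_sum]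
  refine Finset.sum_le_sum fun i _ => Finset.sum_le_sum fun j _ => ?_
  simpa [← abs_mul] using le_abs_self (x i * y j)

variable [DecidableEq ι]

theorem ind_dotProduct (s : Finset ι) (x : ι → ℝ) : ind s ⬝ᵥ x = ∑ i ∈ s, x i := by
  simp [ind, dotProduct, ite_mul, Finset.sum_ite_mem]

theorem sum_ind (s : Finset ι) : ∑ i, ind s i = s.card := by
  simp [ind, Finset.sum_ite_mem]

theorem ind_dotProduct_ind (s t : Finset ι) : ind s ⬝ᵥ ind t = (s ∩ t).card := by
  simp [ind_dotProduct, ind, Finset.sum_ite_mem]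

theorem adjMatrix_mulVec_ind (t : Finset ι) (i : ι) :
    (G.adjMatrix ℝ *ᵥ ind t) i = (G.neighborFinset i ∩ t).card := by
  simp [SimpleGraph.adjMatrix_mulVec_apply, ind, Finset.sum_ite_mem]

theorem adjForm_ind_ind (s t : Finset ι) :
    adjForm G (ind s) (ind t) = ∑ i ∈ s, ((G.neighborFinset i ∩ t).card : ℝ) := by
  rw [adjForm, ind_dotProduct]
  exact Finset.sum_congr rfl fun i _ => adjMatrix_mulVec_ind G t i

variable {G} {lam : ℝ}

/-- For the indicator of a clique on t vertices, the inequality reads t(t-1) ≤ lam·t + t²/2. -/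
theorem FormBound.card_isClique_le (h : FormBound G lam) (hl : 0 < lam) {t : Finset ι}
    (ht : G.IsClique (t : Set ι)) : (t.card : ℝ) ≤ 2 * lam + 2 := by
  have h1 := h (ind t)
  rw [adjForm_ind_ind, ind_dotProduct_ind, sum_ind, Finset.inter_self] at h1
  have h2 : ∀ i ∈ t, ((G.neighborFinset i ∩ t).card : ℝ) = t.card - 1 := by
    intro i hi
    have : G.neighborFinset i ∩ t = t.erase i := by
      ext j
      simp only [Finset.mem_inter, SimpleGraph.mem_neighborFinset, Finset.mem_erase]
      exact ⟨fun hj => ⟨hj.1.ne', hj.2⟩, fun hj => ⟨ht hi hj.2 hj.1.symm, hj.2⟩⟩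
    rw [this, Finset.cast_card_erase_of_mem hi]
  rw [Finset.sum_congr rfl h2, Finset.sum_const, nsmul_eq_mul] at h1
  rcases t.card.eq_zero_or_pos with h0 | h0
  · rw [h0]; push_cast; linarith
  · have h0' : (0 : ℝ) < t.card := by exact_mod_cast h0
    by_contra! hc
    nlinarith

/-- In a large independent set, no vertex has both many neighbours and many non-neighbours. -/
theorem FormBound.card_le_of_split (h : FormBound G lam) (hl : 0 < lam) {C S T : Finset ι} {v : ι}
    (hC : G.IsIndepSet (C : Set ι)) (hv : v ∉ C) (hS : S ⊆ C) (hT : T ⊆ C)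
    (hvS : ∀ i ∈ S, G.Adj v i) (hvT : ∀ i ∈ T, ¬ G.Adj v i) (hST : S.card = T.card) :
    (S.card : ℝ) ≤ 2 * lam ^ 2 + lam := by
  have hz : ∀ s t : Finset ι, s ⊆ C → t ⊆ C → adjForm G (ind s) (ind t) = 0 := by
    intro s t hs ht
    rw [adjForm_ind_ind]
    refine Finset.sum_eq_zero fun i hi => ?_
    rw [Nat.cast_eq_zero, Finset.card_eq_zero, Finset.eq_empty_iff_forall_notMem]
    intro j hj
    rw [Finset.mem_inter, SimpleGraph.mem_neighborFinset] at hj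
    exact hC (hs hi) (ht hj.2) hj.1.ne hj.1
  have hvv : adjForm G (ind {v}) (ind {v}) = 0 := by
    simp [adjForm_ind_ind]
  have hvs : adjForm G (ind {v}) (ind S) = S.card := by
    rw [adjForm_ind_ind, Finset.sum_singleton, Finset.inter_eq_right.2]
    intro i hi; simpa using hvS i hi
  have hvt : adjForm G (ind {v}) (ind T) = 0 := by
    rw [adjForm_ind_ind, Finset.sum_singleton, Nat.cast_eq_zero, Finset.card_eq_zero,
      Finset.eq_empty_iff_forall_notMem]
    intro i hi
    rw [Finset.mem_inter, SimpleGraph.mem_neighborFinset] at hi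
    exact hvT i hi.2 hi.1
  have hd : Disjoint S T := Finset.disjoint_left.2 fun i h1 h2 => hvT i h2 (hvS i h1)
  have hvS' : v ∉ S := fun hh => hv (hS hh)
  have hvT' : v ∉ T := fun hh => hv (hT hh)
  -- Subtracting T cancels the sum of S but costs nothing in the form: 4·lam·|S| ≤ lam·(4·lam² +
  -- 2|S|) + 2·lam².
  have h1 := h ((2 * lam) • ind {v} + ind S - ind T)
  have hsum : ∑ i, ((2 * lam) • ind {v} + ind S - ind T) i = 2 * lam := by
    simp [Finset.sum_add_distrib, Finset.sum_sub_distrib, ← Finset.mul_sum, sum_ind, hST]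
  have hsq : ((2 * lam) • ind {v} + ind S - ind T) ⬝ᵥ ((2 * lam) • ind {v} + ind S - ind T)
      = 4 * lam ^ 2 + 2 * S.card := by
    simp only [add_dotProduct, sub_dotProduct, smul_dotProduct, dotProduct_add, dotProduct_sub,
      dotProduct_smul, ind_dotProduct_ind, Finset.inter_self, smul_eq_mul,
      Finset.singleton_inter_of_notMem hvS', Finset.singleton_inter_of_notMem hvT',
      Finset.inter_singleton_of_notMem hvS', Finset.inter_singleton_of_notMem hvT',
      Finset.disjoint_iff_inter_eq_empty.1 hd, Finset.disjoint_iff_inter_eq_empty.1 hd.symm, hST]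
    simp
    ring
  rw [hsum, hsq] at h1
  simp only [adjForm_add_left, adjForm_sub_left, adjForm_smul_left, adjForm_add_right,
    adjForm_sub_right, adjForm_smul_right, hvv, hvs, hvt, hz S S hS hS, hz S T hS hT,
    hz T S hT hS, hz T T hT hT, adjForm_comm G (ind S) (ind {v}),
    adjForm_comm G (ind T) (ind {v})] at h1
  by_contra! hc
  nlinarith [mul_pos hl (sub_pos.2 hc)]

/-- If every vertex has few neighbours in a large set of vertices, then all degrees are small. -/
theorem FormBound.degree_lt (h : FormBound G lam) (hl : 0 < lam) {C : Finset ι} {k D : ℕ}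
    (hk : ∀ v, (G.neighborFinset v ∩ C).card ≤ k) (hD : lam ^ 2 + 1 < D)
    (hC : (2 * k + lam) * (lam + D) ^ 2 ≤ lam * C.card) (u : ι) : G.degree u < D := by
  by_contra! hdeg
  rw [← SimpleGraph.card_neighborFinset_eq_degree] at hdeg
  obtain ⟨T, hTs, hTc⟩ := Finset.exists_subset_card_eq hdeg
  have huT : u ∉ T := fun hh => by simpa using hTs hh
  have hD0 : (0 : ℝ) < D := by nlinarith
  have hC0 : (0 : ℝ) < C.card := by
    have : 0 < (2 * k + lam) * (lam + D) ^ 2 := by positivity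
    exact pos_of_mul_pos_right (this.trans_le hC) hl.le
  -- The star vector y satisfies A(y,y) - lam·(y·y) ≥ lam·(D - lam²) > lam. Subtracting its mass
  -- spread evenly over C kills the J term, and the size of C keeps the cost of this at most lam.
  set q : ℝ := (lam + D) / C.card with hq
  have hq0 : 0 < q := by positivity
  have hqC : q * C.card = lam + D := by rw [hq]; field_simp
  set y : ι → ℝ := lam • ind {u} + ind T with hy
  have hy0 : 0 ≤ y := add_nonneg (smul_nonneg hl.le (ind_nonneg _)) (ind_nonneg _)
  have hysum : ∑ i, y i = lam + D := by
    simp [hy, Finset.sum_add_distrib, ← Finset.mul_sum, sum_ind, hTc]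
  have h1 := h (y - q • ind C)
  have hsum : ∑ i, (y - q • ind C) i = 0 := by
    simp only [Pi.sub_apply, Finset.sum_sub_distrib, hysum, Pi.smul_apply, smul_eq_mul,
      ← Finset.mul_sum, sum_ind, hqC, sub_self]
  have hyy : y ⬝ᵥ y = lam ^ 2 + D := by
    simp only [hy, add_dotProduct, smul_dotProduct, dotProduct_add, dotProduct_smul,
      ind_dotProduct_ind, Finset.inter_self, smul_eq_mul, Finset.singleton_inter_of_notMem huT,
      Finset.inter_singleton_of_notMem huT, hTc]
    simp
    ring
  have hyC : 0 ≤ y ⬝ᵥ ind C := dotProduct_nonneg_of_nonneg hy0 (ind_nonneg _)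
  have hsq : (y - q • ind C) ⬝ᵥ (y - q • ind C) ≤ lam ^ 2 + D + q * (lam + D) := by
    simp only [sub_dotProduct, dotProduct_sub, smul_dotProduct, dotProduct_smul, hyy,
      ind_dotProduct_ind, Finset.inter_self, smul_eq_mul, dotProduct_comm (ind C) y, hqC]
    nlinarith
  have hAy : 2 * lam * D ≤ adjForm G y y := by
    have huT' : adjForm G (ind {u}) (ind T) = D := by
      rw [adjForm_ind_ind, Finset.sum_singleton, Finset.inter_eq_right.2 hTs, hTc]
    simp only [hy, adjForm_add_left, adjForm_smul_left, adjForm_add_right,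
      adjForm_smul_right, adjForm_comm G (ind T) (ind {u}), huT']
    have e1 := adjForm_nonneg G (ind_nonneg {u}) (ind_nonneg {u})
    have e2 := adjForm_nonneg G (ind_nonneg T) (ind_nonneg T)
    have e3 := mul_nonneg hl.le (mul_nonneg hl.le e1)
    linarith
  have hAyC : adjForm G y (ind C) ≤ k * (lam + D) := by
    rw [adjForm, dotProduct, ← hysum, Finset.mul_sum]
    refine Finset.sum_le_sum fun i _ => ?_
    rw [adjMatrix_mulVec_ind, mul_comm]
    exact mul_le_mul_of_nonneg_right (by exact_mod_cast hk i) (hy0 i)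
  have hACC := adjForm_nonneg G (ind_nonneg C) (ind_nonneg C)
  rw [hsum] at h1
  simp only [adjForm_sub_left, adjForm_smul_left, adjForm_sub_right, adjForm_smul_right,
    adjForm_comm G (ind C) y] at h1
  have e1 := mul_nonneg hq0.le (mul_nonneg hq0.le hACC)
  have e2 := mul_le_mul_of_nonneg_left hAyC hq0.le
  have e3 := mul_le_mul_of_nonneg_left hsq hl.le
  have e4 : (2 * k + lam) * (lam + D) * q ≤ lam := by
    rw [hq, ← mul_div_assoc, div_le_iff₀ hC0]
    linarith
  nlinarith [mul_pos hl (sub_pos.2 hD)]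

end Graph

/-! ### Multiplicity of the eigenvalue lam -/

section Spectral

set_option linter.unusedSectionVars false

variable {ι : Type} [Fintype ι] [DecidableEq ι] {G : SimpleGraph ι} [DecidableRel G.Adj] {lam : ℝ}

theorem dotProduct_abs_self (x : ι → ℝ) : |x| ⬝ᵥ |x| = x ⬝ᵥ x := by
  simp [dotProduct]

/-- If the quadratic form of `A - lam • 1` is positive at a vector supported on `B`, then it is
negative definite on the vectors which vanish on `B` and on its neighbourhood. -/
theorem FormBound.eq_zero_of_separated (h : FormBound G lam) {B : Finset ι} {f g : ι → ℝ}
    (hf : ∀ i, i ∉ B → f i = 0) (hfB : lam * (f ⬝ᵥ f) < adjForm G f f)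
    (hg : ∀ i ∈ B ∪ B.biUnion (G.neighborFinset ·), g i = 0)
    (hgB : lam * (g ⬝ᵥ g) ≤ adjForm G g g) : g = 0 := by
  -- These weights give a|f| - b|g| coordinate sum zero. The supports are disjoint and not joined by
  -- edges, so cross terms vanish, and the strict excess at f forces a = 0.
  set a : ℝ := ∑ i, |g| i with ha
  set b : ℝ := ∑ i, |f| i with hb
  have hsum : ∑ i, (a • |f| - b • |g|) i = 0 := by
    simp only [Pi.sub_apply, Pi.smul_apply, smul_eq_mul, Finset.sum_sub_distrib, ← Finset.mul_sum]
    rw [← ha, ← hb]; ring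
  have hfg : |f| ⬝ᵥ |g| = 0 := by
    refine Finset.sum_eq_zero fun i _ => ?_
    by_cases hi : i ∈ B
    · simp [hg i (Finset.mem_union_left _ hi)]
    · simp [hf i hi]
  have hAfg : adjForm G |f| |g| = 0 := by
    rw [adjForm_eq_sum]
    refine Finset.sum_eq_zero fun i _ => Finset.sum_eq_zero fun j hj => ?_
    by_cases hi : i ∈ B
    · simp [hg j (Finset.mem_union_right _ (Finset.mem_biUnion.2 ⟨i, hi, hj⟩))]
    · simp [hf i hi]
  have h1 := h (a • |f| - b • |g|)
  rw [hsum] at h1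
  simp only [adjForm_sub_left, adjForm_smul_left, adjForm_sub_right, adjForm_smul_right,
    adjForm_comm G |g| |f|, hAfg, sub_dotProduct, dotProduct_sub, smul_dotProduct, dotProduct_smul,
    dotProduct_comm |g| |f|, hfg, smul_eq_mul, dotProduct_abs_self] at h1
  have h2 := hfB.trans_le (adjForm_le_abs G f f)
  have h3 := hgB.trans (adjForm_le_abs G g g)
  have ha0 : a = 0 := by
    by_contra hne
    have e1 := mul_pos (pow_pos (lt_of_le_of_ne
      (Finset.sum_nonneg fun i _ => abs_nonneg (g i)) (Ne.symm hne) : 0 < a) 2) (sub_pos.2 h2)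
    have e2 := mul_nonneg (sq_nonneg b) (sub_nonneg.2 h3)
    nlinarith
  funext i
  have := (Finset.sum_eq_zero_iff_of_nonneg fun i _ => abs_nonneg (g i)).1 ha0 i (Finset.mem_univ i)
  simpa using this

theorem adjForm_eq_of_eigen {x : ι → ℝ} (hx : G.adjMatrix ℝ *ᵥ x = lam • x) :
    adjForm G x x = lam * (x ⬝ᵥ x) := by
  rw [adjForm, hx, dotProduct_smul, smul_eq_mul]

theorem finrank_le_card_of_eq_zero {U : Submodule ℝ (ι → ℝ)} {S : Finset ι}
    (h : ∀ x ∈ U, (∀ i ∈ S, x i = 0) → x = 0) : Module.finrank ℝ U ≤ S.card := by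
  have hinj : Function.Injective ((LinearMap.funLeft ℝ ℝ ((↑) : S → ι)).comp U.subtype) := by
    rw [← LinearMap.ker_eq_bot, LinearMap.ker_eq_bot']
    intro x hx
    exact Subtype.ext (h x x.2 fun i hi => congrFun hx ⟨i, hi⟩)
  simpa using LinearMap.finrank_le_finrank_of_injective hinj

/-- The eigenspace bound when the quadratic form of `A - lam • 1` is positive at some vector of
bounded support. -/
theorem FormBound.finrank_le_of_support (h : FormBound G lam) {B : Finset ι} {f : ι → ℝ}
    (hf : ∀ i, i ∉ B → f i = 0) (hfB : lam * (f ⬝ᵥ f) < adjForm G f f)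
    {U : Submodule ℝ (ι → ℝ)} (hU : ∀ x ∈ U, G.adjMatrix ℝ *ᵥ x = lam • x) {D : ℕ}
    (hD : ∀ v, G.degree v ≤ D) : Module.finrank ℝ U ≤ B.card * (D + 1) := by
  -- Eigenvectors attain equality in the form, so restriction to B and its neighbours is injective
  -- on U.
  refine (finrank_le_card_of_eq_zero (S := B ∪ B.biUnion (G.neighborFinset ·)) fun x hx hx0 =>
    h.eq_zero_of_separated hf hfB hx0 (adjForm_eq_of_eigen (hU x hx)).ge).trans ?_
  refine (Finset.card_union_le _ _).trans ?_
  have := Finset.card_biUnion_le_card_mul B (G.neighborFinset ·) D fun v _ => by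
    rw [SimpleGraph.card_neighborFinset_eq_degree]; exact hD v
  linarith

/-- The vertices at distance at most two from `v` (up to `v` itself). -/
def twoBall (G : SimpleGraph ι) [DecidableRel G.Adj] (v : ι) : Finset ι :=
  G.neighborFinset v ∪ (G.neighborFinset v).biUnion (G.neighborFinset ·)

theorem card_twoBall_le {D : ℕ} (hD : ∀ v, G.degree v ≤ D) (v : ι) :
    (twoBall G v).card ≤ D * (D + 1) := by
  refine (Finset.card_union_le _ _).trans ?_
  have h1 := Finset.card_biUnion_le_card_mul (G.neighborFinset v) (G.neighborFinset ·) D fun v _ => by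
    rw [SimpleGraph.card_neighborFinset_eq_degree]; exact hD v
  have h2 := hD v
  rw [SimpleGraph.card_neighborFinset_eq_degree] at *
  nlinarith

/-- Since -A(h,h) ≤ A(|h|,|h|), the upper bound on the form over B is automatically two-sided.
Polarization uses the upper bound at f + g and the lower one at f - g. -/
theorem adjForm_le_of_forall_le {B : Finset ι}
    (hB : ∀ f : ι → ℝ, (∀ i, i ∉ B → f i = 0) → adjForm G f f ≤ lam * (f ⬝ᵥ f))
    {f g : ι → ℝ} (hf : ∀ i, i ∉ B → f i = 0) (hg : ∀ i, i ∉ B → g i = 0) :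
    2 * adjForm G f g ≤ lam * (f ⬝ᵥ f + g ⬝ᵥ g) := by
  have h1 := hB (f + g) fun i hi => by simp [hf i hi, hg i hi]
  have h2 := hB |f - g| fun i hi => by simp [hf i hi, hg i hi]
  have h3 := adjForm_le_abs G (f - g) (g - f)
  rw [← neg_sub f g, abs_neg, neg_sub] at h3
  rw [dotProduct_abs_self] at h2
  replace h2 := h3.trans h2
  simp only [adjForm_add_left, adjForm_add_right, adjForm_sub_left, adjForm_sub_right,
    adjForm_comm G g f, add_dotProduct, dotProduct_add, sub_dotProduct, dotProduct_sub,
    dotProduct_comm g f] at h1 h2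
  linarith

/-- A local degree inequality, expressing that `‖A (A e_v)‖ ≤ lam * ‖A e_v‖`. -/
theorem degree_sq_add_le (hl : 0 < lam) {v : ι}
    (hB : ∀ f : ι → ℝ, (∀ i, i ∉ twoBall G v → f i = 0) → adjForm G f f ≤ lam * (f ⬝ᵥ f)) :
    (G.degree v : ℝ) ^ 2 + ∑ u ∈ G.neighborFinset v, (G.degree u : ℝ)
      ≤ (lam ^ 2 + 1) * G.degree v := by
  set y : ι → ℝ := ind (G.neighborFinset v) with hy
  set z : ι → ℝ := G.adjMatrix ℝ *ᵥ y with hz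
  have hzi : ∀ i, z i = (G.neighborFinset i ∩ G.neighborFinset v).card := fun i => by
    rw [hz, hy, adjMatrix_mulVec_ind]
  have hys : ∀ i, i ∉ twoBall G v → y i = 0 := by
    intro i hi
    rw [hy, ind, if_neg fun hh => hi (Finset.mem_union_left _ hh)]
  have hzs : ∀ i, i ∉ twoBall G v → z i = 0 := by
    intro i hi
    rw [hzi, Nat.cast_eq_zero, Finset.card_eq_zero, Finset.eq_empty_iff_forall_notMem]
    intro j hj
    rw [Finset.mem_inter, SimpleGraph.mem_neighborFinset] at hj
    exact hi (Finset.mem_union_right _ (Finset.mem_biUnion.2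
      ⟨j, hj.2, by simpa using hj.1.symm⟩))
  -- As A(z,y) = z·z, scaling y by lam yields exactly z·z ≤ lam²·(y·y).
  have h1 := adjForm_le_of_forall_le hB (f := z) (g := lam • y) hzs
    fun i hi => by simp [hys i hi]
  have hzy : adjForm G z y = z ⬝ᵥ z := rfl
  have hyy : y ⬝ᵥ y = G.degree v := by
    rw [hy, ind_dotProduct_ind, Finset.inter_self, SimpleGraph.card_neighborFinset_eq_degree]
  simp only [adjForm_smul_right, hzy, smul_dotProduct, dotProduct_smul, smul_eq_mul, hyy] at h1
  have h2 : z ⬝ᵥ z ≤ lam ^ 2 * G.degree v := by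
    have : lam * (z ⬝ᵥ z) ≤ lam * (lam ^ 2 * G.degree v) := by linarith
    exact le_of_mul_le_mul_left this hl
  have hzsum : ∑ i, z i = ∑ u ∈ G.neighborFinset v, (G.degree u : ℝ) := by
    have e := adjForm_comm G (ind Finset.univ) y
    rw [adjForm, ind_dotProduct] at e
    rw [hz, e, hy, adjForm_ind_ind]
    simp
  have hzv : z v = G.degree v := by
    rw [hzi, Finset.inter_self, SimpleGraph.card_neighborFinset_eq_degree]
  -- The entries of z are natural numbers, so each is at most its square; the entry at v, equal to
  -- the degree, is kept exactly.
  have h3 : (G.degree v : ℝ) ^ 2 - G.degree v + ∑ i, z i ≤ z ⬝ᵥ z := by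
    rw [dotProduct, ← Finset.add_sum_erase _ z (Finset.mem_univ v),
      ← Finset.add_sum_erase _ (fun i => z i * z i) (Finset.mem_univ v), hzv]
    have : ∑ i ∈ Finset.univ.erase v, z i ≤ ∑ i ∈ Finset.univ.erase v, z i * z i := by
      refine Finset.sum_le_sum fun i _ => ?_
      rw [hzi]
      exact_mod_cast Nat.le_mul_self _
    linarith
  linarith

/-- Each degree is counted once for every neighbour. -/
theorem sum_sum_degree : ∑ v, ∑ u ∈ G.neighborFinset v, (G.degree u : ℝ) =
    ∑ v, (G.degree v : ℝ) ^ 2 := by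
  have e : adjForm G (fun _ => 1) (fun u => (G.degree u : ℝ))
      = ∑ v, ∑ u ∈ G.neighborFinset v, (G.degree u : ℝ) := by
    simp [adjForm_eq_sum]
  rw [← e, adjForm_comm, adjForm_eq_sum]
  simp [sq]

/-- The average degree bound obtained from the local degree inequalities. -/
theorem sum_degree_le (hv : ∀ v, (G.degree v : ℝ) ^ 2 +
    ∑ u ∈ G.neighborFinset v, (G.degree u : ℝ) ≤ (lam ^ 2 + 1) * G.degree v) :
    2 * ∑ v, (G.degree v : ℝ) ≤ (lam ^ 2 + 1) * Fintype.card ι := by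
  have h1 := Finset.sum_le_sum fun v (_ : v ∈ Finset.univ) => hv v
  rw [Finset.sum_add_distrib, sum_sum_degree, ← Finset.mul_sum] at h1
  have h2 := sq_sum_le_card_mul_sum_sq (s := Finset.univ) (f := fun v => (G.degree v : ℝ))
  rw [Finset.card_univ] at h2
  set s := ∑ v, (G.degree v : ℝ)
  have hs : 0 ≤ s := Finset.sum_nonneg fun _ _ => Nat.cast_nonneg _
  rcases hs.eq_or_lt with hs | hs
  · rw [← hs]; simp; positivity
  · have hN : (0 : ℝ) ≤ Fintype.card ι := Nat.cast_nonneg _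
    have : s * (2 * s) ≤ s * ((lam ^ 2 + 1) * Fintype.card ι) := by nlinarith
    exact le_of_mul_le_mul_left this hs

/-- A trace bound for the multiplicity of an eigenvalue. -/
theorem finrank_mul_sq_le {U : Submodule ℝ (ι → ℝ)}
    (hU : ∀ x ∈ U, G.adjMatrix ℝ *ᵥ x = lam • x) (c : ℝ) :
    Module.finrank ℝ U * (lam + c) ^ 2 ≤ ∑ v, (G.degree v : ℝ) + c ^ 2 * Fintype.card ι := by
  let e := (WithLp.linearEquiv 2 ℝ (ι → ℝ)).symm
  let U' : Submodule ℝ (EuclideanSpace ℝ ι) := U.map e.toLinearMap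
  have hfr : Module.finrank ℝ U' = Module.finrank ℝ U := LinearEquiv.finrank_map_eq e U
  let b := stdOrthonormalBasis ℝ U'
  -- Bessel's inequality is applied to each row of A + cI; the squared row norms add up to the trace
  -- of (A + cI)². The shift c is free for optimization.
  let r : ι → EuclideanSpace ℝ ι := fun v => WithLp.toLp 2 ((G.adjMatrix ℝ + c • 1) v)
  have hb : Orthonormal ℝ fun i => (b i : EuclideanSpace ℝ ι) :=
    b.orthonormal.comp_linearIsometry U'.subtypeₗᵢ
  have hinner : ∀ i v, inner ℝ (b i : EuclideanSpace ℝ ι) (r v) =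
      (lam + c) * (b i : EuclideanSpace ℝ ι) v := by
    intro i v
    obtain ⟨x, hx, hxb⟩ := (b i).2
    rw [← hxb]
    have h1 := congrFun (hU x hx) v
    have : inner ℝ (e x) (r v) = ((G.adjMatrix ℝ + c • 1) *ᵥ x) v := by
      simp [PiLp.inner_apply, Matrix.mulVec, dotProduct, r, e]
    refine this.trans ?_
    rw [Matrix.add_mulVec, Pi.add_apply, h1, Matrix.smul_mulVec, Matrix.one_mulVec]
    simp [e]
    ring
  have hr : ∀ v, ‖r v‖ ^ 2 = G.degree v + c ^ 2 := by
    intro v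
    have : ∀ j, ((G.adjMatrix ℝ + c • 1) v j) ^ 2 =
        (if j ∈ G.neighborFinset v then 1 else 0) + if v = j then c ^ 2 else 0 := by
      intro j
      by_cases hvj : v = j
      · subst hvj; simp
      · simp [hvj, SimpleGraph.adjMatrix_apply]
    rw [EuclideanSpace.real_norm_sq_eq]
    simp only [r, this, Finset.sum_add_distrib, Finset.sum_ite_mem, Finset.sum_ite_eq]
    simp
  have hbessel : ∀ v, ∑ i, ((lam + c) * (b i : EuclideanSpace ℝ ι) v) ^ 2
      ≤ G.degree v + c ^ 2 := by
    intro v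
    have := hb.sum_inner_products_le (s := Finset.univ) (r v)
    simpa only [hinner, hr, Real.norm_eq_abs, sq_abs] using this
  have hsum := Finset.sum_le_sum fun v (_ : v ∈ Finset.univ) => hbessel v
  rw [Finset.sum_comm] at hsum
  have hone : ∀ i, ∑ v, ((lam + c) * (b i : EuclideanSpace ℝ ι) v) ^ 2 = (lam + c) ^ 2 := by
    intro i
    have := hb.1 i
    have h2 := EuclideanSpace.real_norm_sq_eq (b i : EuclideanSpace ℝ ι)
    rw [this] at h2
    simp only [mul_pow, ← Finset.mul_sum]
    rw [← h2]; simp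
  simp only [hone, Finset.sum_const, Finset.sum_add_distrib, Finset.card_univ, Fintype.card_fin,
    nsmul_eq_mul, hfr] at hsum
  linarith

/-- A graph of maximum degree at most one has no positive eigenvalue other than `1`. -/
theorem eq_zero_of_degree_le_one (hl : 0 < lam) (hl1 : lam ≠ 1) (hd : ∀ v, G.degree v ≤ 1)
    {x : ι → ℝ} (hx : G.adjMatrix ℝ *ᵥ x = lam • x) : x = 0 := by
  have hxv : ∀ v, ∑ u ∈ G.neighborFinset v, x u = lam * x v := fun v => by
    rw [← SimpleGraph.adjMatrix_mulVec_apply, hx]; rfl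
  have hadj : ∀ u v, G.Adj v u → x u = lam * x v := by
    intro u v huv
    have : G.neighborFinset v = {u} := by
      refine (Finset.eq_of_subset_of_card_le (by simpa using huv) ?_).symm
      simpa using hd v
    rw [← hxv, this, Finset.sum_singleton]
  funext v
  have h1 := hxv v
  rcases (G.neighborFinset v).eq_empty_or_nonempty with h0 | ⟨u, hu⟩
  · rw [h0, Finset.sum_empty] at h1
    simpa [hl.ne'] using h1.symm
  · rw [SimpleGraph.mem_neighborFinset] at hu
    have h2 := hadj u v hu
    have h3 := hadj v u hu.symm
    have h4 : (lam - 1) * ((lam + 1) * x v) = 0 := by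
      rw [h2] at h3; linarith
    have h5 : lam + 1 ≠ 0 := by positivity
    simpa [sub_ne_zero.2 hl1, h5] using h4

/-- The main dichotomy: an eigenspace for a value `lam ≠ 1` is bounded or has dimension at most
`3 / 7` of the number of vertices; for `lam = 1`, it is bounded or the graph is a matching. -/
theorem FormBound.finrank_le_or (h : FormBound G lam) (hl : 0 < lam) {D : ℕ}
    (hD : ∀ v, G.degree v ≤ D) {U : Submodule ℝ (ι → ℝ)}
    (hU : ∀ x ∈ U, G.adjMatrix ℝ *ᵥ x = lam • x) :
    Module.finrank ℝ U ≤ D * (D + 1) * (D + 1) ∨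
      (lam ≠ 1 ∧ 7 * Module.finrank ℝ U ≤ 3 * Fintype.card ι) ∨
      (lam = 1 ∧ ∀ v, G.degree v ≤ 1) := by
  by_cases hB : ∀ v, ∀ f : ι → ℝ, (∀ i, i ∉ twoBall G v → f i = 0) →
      adjForm G f f ≤ lam * (f ⬝ᵥ f)
  · right
    have hv := fun v => degree_sq_add_le hl (hB v)
    rcases lt_or_ge (lam ^ 2) 2 with h2 | h2
    · have hd : ∀ v, G.degree v ≤ 1 := by
        intro v
        by_contra! hc
        have hu : (G.degree v : ℝ) ≤ ∑ u ∈ G.neighborFinset v, (G.degree u : ℝ) := by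
          rw [← SimpleGraph.card_neighborFinset_eq_degree, Finset.card_eq_sum_ones, Nat.cast_sum]
          refine Finset.sum_le_sum fun u hu => ?_
          rw [SimpleGraph.mem_neighborFinset] at hu
          exact_mod_cast (G.degree_pos_iff_exists_adj u).2 ⟨v, hu.symm⟩
        have hv' := hv v
        have hc' : (2 : ℝ) ≤ G.degree v := by exact_mod_cast hc
        nlinarith
      by_cases hl1 : lam = 1
      · exact Or.inr ⟨hl1, hd⟩
      · refine Or.inl ⟨hl1, ?_⟩
        have : U = ⊥ := (Submodule.eq_bot_iff U).2 fun x hx =>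
          eq_zero_of_degree_le_one hl hl1 hd (hU x hx)
        rw [this, finrank_bot]; omega
    · refine Or.inl ⟨by rintro rfl; norm_num at h2, ?_⟩
      have h3 := sum_degree_le hv
      -- With this shift, (49/16)·lam²·dim U ≤ ((lam² + 1)/2 + (9/16)·lam²)·N ≤ (21/16)·lam²·N,
      -- using lam² ≥ 2; this is the ratio 3/7.
      have h4 := finrank_mul_sq_le hU (3 / 4 * lam)
      have hN : (0 : ℝ) ≤ Fintype.card ι := Nat.cast_nonneg _
      have h5 : lam ^ 2 * (7 * Module.finrank ℝ U) ≤ lam ^ 2 * (3 * Fintype.card ι) := by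
        nlinarith
      have h6 := le_of_mul_le_mul_left h5 (by positivity)
      exact_mod_cast h6
  · left
    push Not at hB
    obtain ⟨v, f, hf, hfB⟩ := hB
    exact (h.finrank_le_of_support hf hfB hU hD).trans
      (Nat.mul_le_mul_right _ (card_twoBall_le hD v))

/-- In a matching, the eigenvectors for `1` with vanishing coordinate sum span a space of dimension
less than half of the number of vertices. -/
theorem finrank_matching (hd : ∀ v, G.degree v ≤ 1) {W : Submodule ℝ (ι → ℝ)}
    (hW : ∀ x ∈ W, G.adjMatrix ℝ *ᵥ x = x ∧ ∑ i, x i = 0) :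
    W = ⊥ ∨ 2 * Module.finrank ℝ W + 2 ≤ Fintype.card ι := by
  rw [or_iff_not_imp_left]
  intro hne
  obtain ⟨x, hx, hx0⟩ := (Submodule.ne_bot_iff W).1 hne
  let U : Submodule ℝ (ι → ℝ) := LinearMap.ker ((G.adjMatrix ℝ).mulVecLin - LinearMap.id)
  have hU : ∀ x, x ∈ U ↔ G.adjMatrix ℝ *ᵥ x = x := fun x => by
    simp [U, LinearMap.mem_ker, sub_eq_zero]
  have hWU : W ≤ U := fun y hy => (hU y).2 (hW y hy).1
  obtain ⟨v, hv⟩ : ∃ v, x v ≠ 0 := Function.ne_iff.1 hx0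
  have hxv := congrFun (hW x hx).1 v
  rw [SimpleGraph.adjMatrix_mulVec_apply] at hxv
  have hvd : 0 < G.degree v := by
    rw [← SimpleGraph.card_neighborFinset_eq_degree, Finset.card_pos]
    by_contra hh
    rw [Finset.not_nonempty_iff_eq_empty.1 hh, Finset.sum_empty] at hxv
    exact hv hxv.symm
  -- Eigenvectors for 1 are constant on edges and zero at isolated vertices, so |x| is one too. Its
  -- sum is positive, hence W is a proper subspace of U, which saves one dimension.
  have habs : |x| ∈ U := by
    rw [hU]
    funext u
    have hxu := congrFun (hW x hx).1 u
    rw [SimpleGraph.adjMatrix_mulVec_apply] at hxu ⊢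
    have : Nonempty ι := ⟨u⟩
    rcases Finset.card_le_one_iff_subset_singleton.1
      ((G.card_neighborFinset_eq_degree u).trans_le (hd u)) with ⟨w, hw⟩
    rcases Finset.subset_singleton_iff.1 hw with h0 | h0 <;> rw [h0] at hxu ⊢ <;>
      simp at hxu ⊢ <;> simp [← hxu]
  have hlt : W < U := by
    refine lt_of_le_of_ne hWU fun heq => ?_
    rw [← heq] at habs
    have := (Finset.sum_eq_zero_iff_of_nonneg fun i _ => abs_nonneg (x i)).1 (hW _ habs).2 v
      (Finset.mem_univ v)
    simp [hv] at this
  have h1 := Submodule.finrank_lt_finrank_of_lt hlt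
  have h2 := finrank_mul_sq_le (G := G) (lam := 1) (U := U)
    (fun y hy => by rw [one_smul]; exact (hU y).1 hy) 1
  have h3 : ∑ v, (G.degree v : ℝ) ≤ Fintype.card ι :=
    (Finset.sum_le_sum (g := fun _ => 1) fun v _ => Nat.cast_le_one.2 (hd v)).trans_eq (by simp)
  have h4 : 2 * (Module.finrank ℝ U : ℝ) ≤ Fintype.card ι := by linarith
  have h5 : 2 * Module.finrank ℝ U ≤ Fintype.card ι := by exact_mod_cast h4
  omega

end Spectral

/-! ### Gram matrices of equiangular unit vectors -/

section Family

variable {ι : Type} {E : Type*} [NormedAddCommGroup E] [InnerProductSpace ℝ E]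
  {α : ℝ} {w : ι → E}

/-- Unit vectors spanning equiangular lines with common angle `arccos α`. -/
structure IsEquiFamily (α : ℝ) (w : ι → E) : Prop where
  norm_eq_one : ∀ i, ‖w i‖ = 1
  inner_eq : ∀ i j, i ≠ j → inner ℝ (w i) (w j) = α ∨ inner ℝ (w i) (w j) = -α

/-- The graph of obtuse angles of a family of vectors. -/
def negGraph (w : ι → E) : SimpleGraph ι where
  Adj i j := i ≠ j ∧ inner ℝ (w i) (w j) < 0
  symm := ⟨fun i j h => ⟨h.1.symm, by rw [real_inner_comm]; exact h.2⟩⟩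
  loopless := ⟨fun _ h => h.1 rfl⟩

theorem negGraph_adj {i j : ι} :
    (negGraph w).Adj i j ↔ i ≠ j ∧ inner ℝ (w i) (w j) < 0 := Iff.rfl

theorem IsEquiFamily.signs (hw : IsEquiFamily α w) {ε : ι → ℝ} (hε : ∀ i, ε i = 1 ∨ ε i = -1) :
    IsEquiFamily α fun i => ε i • w i where
  norm_eq_one i := by rcases hε i with h | h <;> simp [h, hw.norm_eq_one]
  inner_eq i j hij := by
    rcases hε i with h | h <;> rcases hε j with h' | h' <;>
      rcases hw.inner_eq i j hij with h'' | h'' <;>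
      simp [h, h', h'', inner_neg_left, inner_neg_right]

theorem IsEquiFamily.inner_of_adj (hw : IsEquiFamily α w) (hα : 0 < α) {i j : ι}
    (h : (negGraph w).Adj i j) : inner ℝ (w i) (w j) = -α :=
  (hw.inner_eq i j h.ne).resolve_left fun h' => by
    have := (negGraph_adj.1 h).2; linarith

theorem IsEquiFamily.inner_of_not_adj (hw : IsEquiFamily α w) (hα : 0 < α) {i j : ι} (hij : i ≠ j)
    (h : ¬ (negGraph w).Adj i j) : inner ℝ (w i) (w j) = α :=
  (hw.inner_eq i j hij).resolve_right fun h' => h (negGraph_adj.2 ⟨hij, by linarith⟩)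

section

set_option linter.unusedSectionVars false

variable [Fintype ι]

theorem sum_mul_gram {G : SimpleGraph ι} [DecidableRel G.Adj] (α : ℝ) (x : ι → ℝ) :
    ∑ i, x i * ((1 - α) * x i + α * ∑ j, x j - 2 * α * (G.adjMatrix ℝ *ᵥ x) i) =
      (1 - α) * (x ⬝ᵥ x) + α * (∑ i, x i) ^ 2 - 2 * α * adjForm G x x := by
  simp only [mul_add, mul_sub, Finset.sum_add_distrib, Finset.sum_sub_distrib, adjForm,
    dotProduct, Finset.mul_sum, sq, Finset.sum_mul]
  congr 1
  · congr 1
    · exact Finset.sum_congr rfl fun i _ => by ring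
    · rw [Finset.sum_comm]
      exact Finset.sum_congr rfl fun i _ => Finset.sum_congr rfl fun j _ => by ring
  · exact Finset.sum_congr rfl fun i _ => by ring

variable [DecidableEq ι] [DecidableRel (negGraph w).Adj]

theorem IsEquiFamily.inner_sum (hw : IsEquiFamily α w) (hα : 0 < α) (x : ι → ℝ) (i : ι) :
    inner ℝ (w i) (∑ j, x j • w j) =
      (1 - α) * x i + α * ∑ j, x j - 2 * α * ((negGraph w).adjMatrix ℝ *ᵥ x) i := by
  have h : ∀ j, inner ℝ (w i) (x j • w j) = (1 - α) * (if i = j then x j else 0) + α * x j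
      - 2 * α * ((negGraph w).adjMatrix ℝ i j * x j) := by
    intro j
    rw [inner_smul_right]
    by_cases hij : i = j
    · subst hij
      rw [real_inner_self_eq_norm_sq, hw.norm_eq_one]
      simp; ring
    · by_cases ha : (negGraph w).Adj i j
      · rw [hw.inner_of_adj hα ha]
        simp [hij, ha]; ring
      · rw [hw.inner_of_not_adj hα hij ha]
        simp [hij, ha]; ring
  rw [_root_.inner_sum, Finset.sum_congr rfl fun j _ => h j, Finset.sum_sub_distrib,
    Finset.sum_add_distrib, ← Finset.mul_sum, ← Finset.mul_sum, ← Finset.mul_sum,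
    Finset.sum_ite_eq]
  simp [Matrix.mulVec, dotProduct]

theorem IsEquiFamily.formBound (hw : IsEquiFamily α w) (hα : 0 < α) :
    FormBound (negGraph w) ((1 - α) / (2 * α)) := by
  intro x
  have h : 0 ≤ inner ℝ (∑ i, x i • w i) (∑ j, x j • w j) := real_inner_self_nonneg
  rw [sum_inner] at h
  simp only [inner_smul_left, hw.inner_sum hα, conj_trivial] at h
  rw [sum_mul_gram] at h
  have h3 : 2 * α * adjForm (negGraph w) x x ≤
      2 * α * ((1 - α) / (2 * α) * (x ⬝ᵥ x) + (∑ i, x i) ^ 2 / 2) := by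
    have : 2 * α * ((1 - α) / (2 * α) * (x ⬝ᵥ x) + (∑ i, x i) ^ 2 / 2) =
      (1 - α) * (x ⬝ᵥ x) + α * (∑ i, x i) ^ 2 := by field_simp
    linarith
  exact le_of_mul_le_mul_left h3 (by positivity)

end

end Family

/-- A dimension count for a common kernel. -/
theorem card_le_finrank_ker_add {ι F : Type} [Fintype ι] [AddCommGroup F] [Module ℝ F]
    [FiniteDimensional ℝ F] (f : (ι → ℝ) →ₗ[ℝ] F) :
    Fintype.card ι ≤ Module.finrank ℝ (LinearMap.ker f) + Module.finrank ℝ F := by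
  have h1 := f.finrank_range_add_finrank_ker
  have h2 := Submodule.finrank_le (LinearMap.range f)
  rw [Module.finrank_fintype_fun_eq_card] at h1
  omega

/-- Apply 2ab ≤ a² + b² along each edge; every vertex lies on at most one. -/
theorem adjForm_self_le_of_degree_le_one {ι : Type} [Fintype ι] {G : SimpleGraph ι}
    [DecidableRel G.Adj] (hd : ∀ v, G.degree v ≤ 1) (x : ι → ℝ) : adjForm G x x ≤ x ⬝ᵥ x := by
  have e := adjForm_comm G (fun i => x i ^ 2) (fun _ => 1)
  have h1 : 2 * adjForm G x x ≤ adjForm G (fun i => x i ^ 2) (fun _ => 1) +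
      adjForm G (fun _ => 1) (fun i => x i ^ 2) := by
    simp only [adjForm_eq_sum, Finset.mul_sum, ← Finset.sum_add_distrib]
    refine Finset.sum_le_sum fun i _ => Finset.sum_le_sum fun j _ => ?_
    nlinarith [sq_nonneg (x i - x j)]
  have h2 : adjForm G (fun i => x i ^ 2) (fun _ => 1) ≤ x ⬝ᵥ x := by
    rw [adjForm_eq_sum]
    refine Finset.sum_le_sum fun i _ => ?_
    have : (G.degree i : ℝ) ≤ 1 := Nat.cast_le_one.2 (hd i)
    simp
    nlinarith [sq_nonneg (x i)]
  linarith

open Classical in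
/-- After suitable sign changes, the graph of obtuse angles has bounded degree. -/
theorem exists_signs_degree_le {α : ℝ} (hα : α ∈ Set.Ioo (0 : ℝ) 1) :
    ∃ R D : ℕ, ∀ (ι E : Type) [Fintype ι] [NormedAddCommGroup E] [InnerProductSpace ℝ E]
      (w : ι → E), IsEquiFamily α w → R ≤ Fintype.card ι →
      ∃ ε : ι → ℝ, (∀ i, ε i = 1 ∨ ε i = -1) ∧
        ∀ v, (negGraph fun i => ε i • w i).degree v ≤ D := by
  obtain ⟨hα0, hα1⟩ := hα
  set lam : ℝ := (1 - α) / (2 * α) with hlam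
  have hl : 0 < lam := div_pos (by linarith) (by linarith)
  -- The constants violate, in turn, the split bound and the clique bound, and then meet the two
  -- hypotheses of `FormBound.degree_lt`. Ramsey must therefore produce an independent set of size
  -- l.
  obtain ⟨k, hk⟩ := exists_nat_gt (2 * lam ^ 2 + lam)
  obtain ⟨c, hc⟩ := exists_nat_gt (2 * lam + 2)
  obtain ⟨D, hD⟩ := exists_nat_gt (lam ^ 2 + 1)
  obtain ⟨l, hL⟩ := exists_nat_gt ((2 * k + lam) * (lam + D) ^ 2 / lam)
  rw [div_lt_iff₀ hl] at hL
  obtain ⟨R, hR⟩ := exists_ramsey_bound c l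
  refine ⟨R, D, fun ι E _ _ _ w hw hcard => ?_⟩
  obtain ⟨t, -, htc, ht⟩ | ⟨C, -, hCc, hC⟩ := hR ι (negGraph w) Finset.univ hcard
  · have := (hw.formBound hα0).card_isClique_le hl ht
    rw [htc] at this
    linarith
  -- Flip the vertices outside C with at least k neighbours in C. Their new neighbours in C are the
  -- old non-neighbours, and the split bound allows at most k of these.
  let ε : ι → ℝ := fun v =>
    if v ∉ C ∧ k ≤ ((negGraph w).neighborFinset v ∩ C).card then -1 else 1
  have hε : ∀ i, ε i = 1 ∨ ε i = -1 := fun i => by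
    by_cases h : i ∉ C ∧ k ≤ ((negGraph w).neighborFinset i ∩ C).card
    · exact Or.inr (if_pos h)
    · exact Or.inl (if_neg h)
  have hεC : ∀ i ∈ C, ε i = 1 := fun i hi => if_neg fun h => h.1 hi
  refine ⟨ε, hε, fun v => ?_⟩
  have hw' := hw.signs hε
  refine ((hw'.formBound hα0).degree_lt hl (C := C) (k := k) (fun v => ?_) hD ?_ v).le
  · by_cases hv : v ∉ C ∧ k ≤ ((negGraph w).neighborFinset v ∩ C).card
    · have hεv : ε v = -1 := if_pos hv
      by_contra! hlt
      obtain ⟨S, hS, hSc⟩ := Finset.exists_subset_card_eq hv.2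
      obtain ⟨T, hT, hTc⟩ := Finset.exists_subset_card_eq hlt.le
      have := (hw.formBound hα0).card_le_of_split hl hC hv.1
        (hS.trans Finset.inter_subset_right) (hT.trans Finset.inter_subset_right)
        (fun i hi => by simpa using (Finset.mem_inter.1 (hS hi)).1)
        (fun i hi hadj => by
          have h1 := Finset.mem_inter.1 (hT hi)
          rw [SimpleGraph.mem_neighborFinset, negGraph_adj] at h1
          have h2 := h1.1.2
          rw [hεv, hεC i h1.2] at h2
          have h3 := (negGraph_adj.1 hadj).2
          simp only [neg_smul, one_smul, inner_neg_left] at h2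
          linarith) (hSc.trans hTc.symm)
      rw [hSc] at this
      linarith
    · have hεv : ε v = 1 := if_neg hv
      have heq : (negGraph fun i => ε i • w i).neighborFinset v ∩ C =
          (negGraph w).neighborFinset v ∩ C := by
        ext i
        simp only [Finset.mem_inter, SimpleGraph.mem_neighborFinset, negGraph_adj]
        refine and_congr_left fun hi => ?_
        rw [hεv, hεC i hi, one_smul, one_smul]
      rw [heq]
      by_cases hvC : v ∈ C
      · rw [Finset.card_eq_zero.2]
        · exact Nat.zero_le _
        · refine Finset.eq_empty_iff_forall_notMem.2 fun i hi => ?_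
          rw [Finset.mem_inter, SimpleGraph.mem_neighborFinset] at hi
          exact hC hvC hi.2 hi.1.ne hi.1
      · by_contra! hlt
        exact hv ⟨hvC, hlt.le⟩
  · rw [hCc]; linarith

/-- The size of a family of equiangular lines in a Euclidean space, up to a constant. -/
theorem IsEquiFamily.card_le {α : ℝ} (hα : α ∈ Set.Ioo (0 : ℝ) 1) :
    ∃ K : ℕ, ∀ (ι E : Type) [Fintype ι] [NormedAddCommGroup E] [InnerProductSpace ℝ E]
      [FiniteDimensional ℝ E] (w : ι → E), IsEquiFamily α w →
      Fintype.card ι ≤ Module.finrank ℝ E + K ∨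
      (α ≠ 1 / 3 ∧ 4 * Fintype.card ι ≤ 7 * Module.finrank ℝ E + 7) ∨
      (α = 1 / 3 ∧ Fintype.card ι + 2 ≤ 2 * Module.finrank ℝ E) := by
  obtain ⟨R, D, hRD⟩ := exists_signs_degree_le hα
  obtain ⟨hα0, hα1⟩ := hα
  -- R covers small families, the product is the local eigenspace bound, and 1 pays for the
  -- condition of coordinate sum zero.
  refine ⟨R + D * (D + 1) * (D + 1) + 1, fun ι E _ _ _ _ w₀ hw₀ => ?_⟩
  rcases lt_or_ge (Fintype.card ι) R with hR | hR
  · left; omega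
  obtain ⟨ε, hε, hD⟩ := hRD ι E w₀ hw₀ hR
  classical
  set w : ι → E := fun i => ε i • w₀ i with hwdef
  have hw : IsEquiFamily α w := hw₀.signs hε
  set lam : ℝ := (1 - α) / (2 * α) with hlam
  have hl : 0 < lam := div_pos (by linarith) (by linarith)
  have hl1 : lam = 1 ↔ α = 1 / 3 := by
    rw [hlam, div_eq_one_iff_eq (by linarith)]
    constructor <;> intro h <;> linarith
  let s : (ι → ℝ) →ₗ[ℝ] ℝ := Fintype.linearCombination ℝ fun _ => (1 : ℝ)
  let f : (ι → ℝ) →ₗ[ℝ] E := Fintype.linearCombination ℝ w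
  have hs : ∀ x, s x = ∑ i, x i := fun x => by simp [s, Fintype.linearCombination_apply]
  have hf : ∀ x, f x = ∑ i, x i • w i := fun x => by simp [f, Fintype.linearCombination_apply]
  have hker : ∀ x, f x = 0 → ∀ i, (1 - α) * x i + α * ∑ j, x j
      - 2 * α * ((negGraph w).adjMatrix ℝ *ᵥ x) i = 0 := fun x hx i => by
    rw [← hw.inner_sum hα0, ← hf, hx, inner_zero_right]
  have heig : ∀ x, f x = 0 → ∑ i, x i = 0 → (negGraph w).adjMatrix ℝ *ᵥ x = lam • x := by
    intro x hx hx0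
    funext i
    have := hker x hx i
    rw [hx0] at this
    simp only [Pi.smul_apply, smul_eq_mul, hlam]
    field_simp
    linarith
  have hU : ∀ x ∈ LinearMap.ker (f.prod s), (negGraph w).adjMatrix ℝ *ᵥ x = lam • x := by
    intro x hx
    obtain ⟨h1, h2⟩ := Prod.mk_eq_zero.1 (show (f x, s x) = 0 from hx)
    exact heig x h1 (hs x ▸ h2)
  have hcard := card_le_finrank_ker_add (f.prod s)
  rw [Module.finrank_prod, Module.finrank_self] at hcard
  rcases (hw.formBound hα0).finrank_le_or hl hD hU with h | ⟨hne, h⟩ | ⟨heq, hd⟩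
  · left; omega
  · right; left
    exact ⟨fun h => hne (hl1.2 h), by omega⟩
  · have hα3 := hl1.1 heq
    -- For α = 1/3 the sum condition is automatic: A(x,x) ≤ x·x makes the Gram form at least (∑
    -- xᵢ)²/3. Dropping that condition gives the exact bound.
    have hW : ∀ x ∈ LinearMap.ker f, (negGraph w).adjMatrix ℝ *ᵥ x = x ∧ ∑ i, x i = 0 := by
      intro x hx
      rw [LinearMap.mem_ker] at hx
      have h0 : ∑ i, x i = 0 := by
        have h1 := adjForm_self_le_of_degree_le_one hd x
        have h2 : ∑ i, x i * ((1 - α) * x i + α * ∑ j, x j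
            - 2 * α * ((negGraph w).adjMatrix ℝ *ᵥ x) i) = 0 :=
          Finset.sum_eq_zero fun i _ => by rw [hker x hx i, mul_zero]
        rw [sum_mul_gram] at h2
        rw [hα3] at h2
        have h3 : (∑ i, x i) ^ 2 ≤ 0 := by linarith
        exact pow_eq_zero_iff two_ne_zero |>.1 (le_antisymm h3 (sq_nonneg _))
      refine ⟨?_, h0⟩
      rw [heig x hx h0, hl1.2 hα3, one_smul]
    have hcard' := card_le_finrank_ker_add f
    rcases finrank_matching hd hW with h | h
    · left
      rw [h, finrank_bot] at hcard'
      omega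
    · right; right
      exact ⟨hα3, by omega⟩

/-! ### From lines to unit vectors, and attained maxima -/

theorem inner_eq_of_min_angle {E : Type*} [NormedAddCommGroup E] [InnerProductSpace ℝ E]
    {α : ℝ} (hα : α ∈ Set.Ioo (0 : ℝ) 1) {u v : E} (hu : ‖u‖ = 1) (hv : ‖v‖ = 1)
    (h : min (InnerProductGeometry.angle u v) (Real.pi - InnerProductGeometry.angle u v) =
      Real.arccos α) : inner ℝ u v = α ∨ inner ℝ u v = -α := by
  rw [InnerProductGeometry.inner_eq_cos_angle_of_norm_eq_one hu hv]
  have hc : Real.cos (Real.arccos α) = α := Real.cos_arccos (by linarith [hα.1]) hα.2.le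
  rcases min_choice (InnerProductGeometry.angle u v)
    (Real.pi - InnerProductGeometry.angle u v) with h' | h' <;> rw [h'] at h
  · left; rw [h, hc]
  · right
    rw [← h, Real.cos_pi_sub] at hc
    linarith

/-- Unit direction vectors of a set of equiangular lines. -/
theorem IsEquiangular.isEquiFamily {E : Type} [NormedAddCommGroup E] [InnerProductSpace ℝ E]
    {α : ℝ} (hα : α ∈ Set.Ioo (0 : ℝ) 1) {L : Set (ℙ ℝ E)} (hL : IsEquiangular L (Real.arccos α)) :
    IsEquiFamily α fun l : L => ‖(l : ℙ ℝ E).rep‖⁻¹ • (l : ℙ ℝ E).rep := by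
  have hn : ∀ l : ℙ ℝ E, ‖l.rep‖ ≠ 0 := fun l => norm_ne_zero_iff.2 l.rep_nonzero
  have h1 : ∀ l : ℙ ℝ E, ‖‖l.rep‖⁻¹ • l.rep‖ = 1 := fun l => by
    rw [norm_smul, norm_inv, norm_norm, inv_mul_cancel₀ (hn l)]
  refine ⟨fun l => h1 l, fun l m hlm => ?_⟩
  refine inner_eq_of_min_angle hα (h1 l) (h1 m) ?_
  rw [min_angle_smul_smul _ _ (inv_ne_zero (hn l)) (inv_ne_zero (hn m))]
  exact hL l.2 m.2 fun h => hlm (Subtype.ext h)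

theorem encard_le_of_forall_finset {β : Type*} {s : Set β} {N : ℕ}
    (h : ∀ t : Finset β, (t : Set β) ⊆ s → t.card ≤ N) : s.encard ≤ N := by
  by_contra! hlt
  obtain ⟨t, hts, htc⟩ := Set.exists_subset_encard_eq
    (show ((N + 1 : ℕ) : ℕ∞) ≤ s.encard from by
      push_cast; exact Order.add_one_le_of_lt hlt)
  have hfin : t.Finite := Set.finite_of_encard_eq_coe htc
  have h1 := h hfin.toFinset (by simpa using hts)
  rw [hfin.encard_eq_coe_toFinset_card] at htc
  have : hfin.toFinset.card = N + 1 := by exact_mod_cast htc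
  omega

/-- An upper bound for the elements of `cardinalities n θ` follows from one for finite families of
unit vectors. -/
theorem le_of_mem_cardinalities {α : ℝ} (hα : α ∈ Set.Ioo (0 : ℝ) 1) {n N : ℕ}
    (h : ∀ (ι : Type) [Fintype ι] (w : ι → EuclideanSpace ℝ (Fin n)), IsEquiFamily α w →
      Fintype.card ι ≤ N) {k : ℕ∞} (hk : k ∈ cardinalities n (Real.arccos α)) : k ≤ N := by
  obtain ⟨L, hL, rfl⟩ := hk
  refine encard_le_of_forall_finset fun t ht => ?_
  have := h (t : Set (ℙ ℝ (EuclideanSpace ℝ (Fin n)))) _ (IsEquiangular.isEquiFamily hα (hL.mono ht))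
  simpa using this

theorem zero_mem_cardinalities (n : ℕ) (θ : ℝ) : 0 ∈ cardinalities n θ :=
  ⟨∅, by simp [IsEquiangular], by simp⟩

theorem exists_isGreatest {S : Set ℕ∞} {N : ℕ} (h0 : 0 ∈ S) (h : ∀ k ∈ S, k ≤ N) :
    ∃ M : ℕ, IsGreatest S M ∧ M ≤ N := by
  have hfin : S.Finite := by
    refine ((Set.finite_Iic N).image ((↑) : ℕ → ℕ∞)).subset fun k hk => ?_
    obtain ⟨m, rfl⟩ := ENat.ne_top_iff_exists.1 (ne_top_of_le_ne_top (ENat.natCast_ne_top N) (h k hk))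
    exact ⟨m, by exact_mod_cast h _ hk, rfl⟩
  obtain ⟨m, hm⟩ := hfin.exists_maximal ⟨0, h0⟩
  obtain ⟨M, rfl⟩ := ENat.ne_top_iff_exists.1 (ne_top_of_le_ne_top (ENat.natCast_ne_top N) (h m hm.1))
  refine ⟨M, ⟨hm.1, fun k hk => ?_⟩, by exact_mod_cast h _ hm.1⟩
  exact (le_total k M).elim id fun hle => hm.2 hk hle

/-! ### The extremal configuration for α = 1/3 -/

/-- The vectors `e₀ ± √2 eᵢ`, which span `2 n` equiangular lines in `ℝⁿ⁺¹`. -/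
noncomputable def starVector (n : ℕ) (p : Fin n × Bool) : EuclideanSpace ℝ (Fin (n + 1)) :=
  EuclideanSpace.single 0 1 +
    (if p.2 then Real.sqrt 2 else -Real.sqrt 2) • EuclideanSpace.single p.1.succ 1

theorem inner_single_add_smul_single {n : ℕ} (i j : Fin n) (a b : ℝ) :
    inner ℝ (EuclideanSpace.single (0 : Fin (n + 1)) (1 : ℝ) + a • EuclideanSpace.single i.succ (1 : ℝ))
      (EuclideanSpace.single (0 : Fin (n + 1)) (1 : ℝ) + b • EuclideanSpace.single j.succ (1 : ℝ)) =
      1 + if i = j then a * b else 0 := by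
  by_cases hij : i = j
  · subst hij
    simp [PiLp.inner_apply, Fin.sum_univ_succ, PiLp.single_apply, mul_comm, (Fin.succ_ne_zero _).symm]
  · simp [PiLp.inner_apply, Fin.sum_univ_succ, PiLp.single_apply, hij, (Fin.succ_ne_zero _).symm]

theorem inner_starVector (n : ℕ) (p q : Fin n × Bool) :
    inner ℝ (starVector n p) (starVector n q) =
      1 + if p.1 = q.1 then (if p.2 = q.2 then 2 else -2) else 0 := by
  have h2 : Real.sqrt 2 * Real.sqrt 2 = 2 := Real.mul_self_sqrt (by norm_num)
  obtain ⟨i, a⟩ := p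
  obtain ⟨j, b⟩ := q
  rw [starVector, starVector, inner_single_add_smul_single]
  cases a <;> cases b <;> simp [h2]

theorem norm_starVector (n : ℕ) (p : Fin n × Bool) : ‖starVector n p‖ = Real.sqrt 3 := by
  rw [@norm_eq_sqrt_real_inner, inner_starVector]
  norm_num

theorem starVector_ne_zero (n : ℕ) (p : Fin n × Bool) : starVector n p ≠ 0 := by
  rw [← norm_ne_zero_iff, norm_starVector]
  positivity

theorem lineAngle_starVector {n : ℕ} {p q : Fin n × Bool} (hpq : p ≠ q) :
    lineAngle (Projectivization.mk ℝ _ (starVector_ne_zero n p))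
      (Projectivization.mk ℝ _ (starVector_ne_zero n q)) = Real.arccos (1 / 3) := by
  rw [lineAngle_mk, InnerProductGeometry.angle, norm_starVector, norm_starVector, inner_starVector,
    Real.mul_self_sqrt (by norm_num)]
  have hle : Real.arccos (1 / 3) ≤ Real.pi / 2 := Real.arccos_le_pi_div_two.2 (by norm_num)
  -- All squared norms are 3, and distinct vectors have inner product -1 for the same index i and 1
  -- otherwise.
  by_cases h1 : p.1 = q.1
  · have h2 : p.2 ≠ q.2 := fun h2 => hpq (Prod.ext h1 h2)
    rw [if_pos h1, if_neg h2, show ((1 : ℝ) + -2) / 3 = -(1 / 3) by norm_num, Real.arccos_neg,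
      min_eq_right (by linarith)]
    ring
  · rw [if_neg h1, add_zero, min_eq_left (by linarith)]

theorem mem_cardinalities_one_third (n : ℕ) :
    ((2 * n : ℕ) : ℕ∞) ∈ cardinalities (n + 1) (Real.arccos (1 / 3)) := by
  let F : Fin n × Bool → ℙ ℝ (EuclideanSpace ℝ (Fin (n + 1))) := fun p =>
    Projectivization.mk ℝ _ (starVector_ne_zero n p)
  have hself : ∀ l : ℙ ℝ (EuclideanSpace ℝ (Fin (n + 1))), lineAngle l l ≤ 0 := fun l => by
    rw [lineAngle, InnerProductGeometry.angle_self l.rep_nonzero]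
    exact min_le_left _ _
  have hpos : 0 < Real.arccos (1 / 3) := Real.arccos_pos.2 (by norm_num)
  have hF : Function.Injective F := by
    intro p q hpq
    by_contra hne
    have h1 : lineAngle (F p) (F q) = _ := lineAngle_starVector hne
    have h2 := hself (F q)
    rw [hpq] at h1
    linarith
  refine ⟨Set.range F, ?_, ?_⟩
  · rintro _ ⟨p, rfl⟩ _ ⟨q, rfl⟩ hne
    exact lineAngle_starVector fun h => hne (h ▸ rfl)
  · rw [← Set.image_univ, hF.encard_image, Set.encard_univ, ENat.card_eq_coe_fintype_card]
    simp [mul_comm]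

end EquiangularLines

theorem mainTheorem1 (α : ℝ) (hα : α ∈ Set.Ioo (0 : ℝ) 1) :
    ∃ n₀ : ℕ, ∀ n : ℕ, n₀ ≤ n →
      (α = 1 / 3 →
        IsGreatest (EquiangularLines.cardinalities n (Real.arccos α)) ((2 * n - 2 : ℕ) : ℕ∞)) ∧
      (α ≠ 1 / 3 →
        ∃ N : ℕ, IsGreatest (EquiangularLines.cardinalities n (Real.arccos α)) (N : ℕ∞) ∧
          (N : ℝ) ≤ 1.93 * n) := by
  obtain ⟨K, hK⟩ := EquiangularLines.IsEquiFamily.card_le hα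
  -- The term 2K puts n + K below both targets; n ≥ 10 is what 7(n+1)/4 ≤ 1.93n needs.
  refine ⟨2 * K + 10, fun n hn => ⟨fun h3 => ⟨?_, fun k hk => ?_⟩, fun h3 => ?_⟩⟩
  · obtain ⟨m, rfl⟩ : ∃ m, n = m + 1 := ⟨n - 1, by omega⟩
    rw [h3, show 2 * (m + 1) - 2 = 2 * m by omega]
    exact EquiangularLines.mem_cardinalities_one_third m
  · refine EquiangularLines.le_of_mem_cardinalities hα (fun ι _ w hw => ?_) hk
    have := hK ι _ w hw
    rw [finrank_euclideanSpace_fin] at this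
    rcases this with h | ⟨h, -⟩ | ⟨-, h⟩
    · omega
    · exact absurd h3 h
    · omega
  · obtain ⟨N, hN, hNle⟩ := EquiangularLines.exists_isGreatest (N := (193 * n) / 100)
      (EquiangularLines.zero_mem_cardinalities n (Real.arccos α)) fun k hk =>
        EquiangularLines.le_of_mem_cardinalities hα (fun ι _ w hw => by
          have := hK ι _ w hw
          rw [finrank_euclideanSpace_fin] at this
          rcases this with h | ⟨-, h⟩ | ⟨h, -⟩
          · omega
          · omega
          · exact absurd h h3) hk
    refine ⟨N, hN, ?_⟩
    have h1 : N * 100 ≤ 193 * n := by omega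
    have h2 : (N : ℝ) * 100 ≤ 193 * n := by exact_mod_cast h1
    linarith
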